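/- Let $X$ be a measurable space with a $\sigma$-finite measure $\mu$, and let $(\mathcal E,\mathcal F)$ be a Dirichlet form on $L^2(X,\mu)$ whose heat semigroup $(P_t)_{t\ge 0}$ has a nonnegative measurable heat kernel $p_t(x,y)$ with respect to $\mu$, so that $P_tf(x)=\int_X p_t(x,y)f(y)\,d\mu(y)$ for $t>0$. Assume that the semigroup is conservative, $P_t1=1$, and that there are constants $C_h,\beta>0$ such that, for every $t>0$, $p_t(x,y)\le C_ht^{-\beta}$ for $\mu\times\mu$-a.e. $(x,y)$. For $p\ge 1$ and $\alpha\ge 0$ let $\mathbf B^{p,\alpha}(X)$ be the set of all $f\in L^p(X,\mu)$ with $$\limsup_{t\to0^+}t^{-\alpha}\Big(\int_X P_t(|f-f(y)|^p)(y)\,d\mu(y)\Big)^{1/p}<\infty,$$ let $\alpha_p:=\sup\{\alpha>0:\mathbf B^{p,\alpha}(X)\text{ contains a function that is not a.e. constant}\}$ (with $\sup\emptyset:=0$), let $W^{1,p}(\mathcal E):=\mathbf B^{p,\alpha_p}(X)$ if $p>1$ and $BV(\mathcal E):=\mathbf B^{1,\alpha_1}(X)$, and for $f$ in this space let $$\mathbf{Var}_{p,\mathcal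 E}(f):=\liminf_{t\to0^+}t^{-\alpha_p}\Big(\int_X P_t(|f-f(y)|^p)(y)\,d\mu(y)\Big)^{1/p}.$$ Let $p\ge1$. There is a constant $c_p>0$, depending only on $p$, with the following property. Suppose that the $L^p$ pseudo-Poincaré inequality $(\mathrm{PPI}_p)$ holds, that is, for some constant $C_p>0$, $$\|P_tf-f\|_{L^p(X,\mu)}\le C_pt^{\alpha_p}\,\mathbf{Var}_{p,\mathcal E}(f)$$ for all $t\ge0$ and all $f\in W^{1,p}(\mathcal E)$ (all $f\in BV(\mathcal E)$ if $p=1$). Then for every $f\in W^{1,p}(\mathcal E)$ (every $f\in BV(\mathcal E)$ if $p=1$), $$\|f\|_{L^q(X,\mu)}\le c_p\,C_p^{\frac{\beta}{\beta+\alpha_p}}\,C_h^{\frac{\alpha_p}{\beta+\alpha_p}}\,\mathbf{Var}_{p,\mathcal E}(f)^{\frac{\beta}{\beta+\alpha_p}}\,\|f\|_{L^1(X,\mu)}^{\frac{\alpha_p}{\beta+\alpha_p}},\qquad q=p\Big(1+\frac{\alpha_p}{\beta}\Big).$$ Norms take values in $[0,\infty]$; nothing is claimed when $\|f\|_{L^1(X,\mu)}=\infty$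 makes the right-hand side infinite. -/

import Mathlib

open MeasureTheory Filter Topology
open scoped ENNReal

/-- A (symmetric) Dirichlet form on `L²(X, μ)`: a densely defined, symmetric, nonnegative, closed
bilinear form on which the unit contraction operates. -/
structure DirichletForm {X : Type*} [MeasurableSpace X] (μ : Measure X) where
  /-- the domain of the form -/
  domain : Submodule ℝ (Lp ℝ 2 μ)
  /-- the bilinear form -/
  form : domain →ₗ[ℝ] domain →ₗ[ℝ] ℝ
  dense_domain : Dense (domain : Set (Lp ℝ 2 μ))
  symm : ∀ u v : domain, form u v = form v u
  nonneg : ∀ u : domain, 0 ≤ form u u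
  /-- the domain is complete for the inner product `form u v + ⟪u, v⟫` -/
  closed : ∀ u : ℕ → domain,
    (∀ ε : ℝ, 0 < ε → ∃ N : ℕ, ∀ m n : ℕ, N ≤ m → N ≤ n →
      form (u m - u n) (u m - u n) + ‖((u m - u n : domain) : Lp ℝ 2 μ)‖ ^ 2 < ε) →
    ∃ v : domain, Tendsto
      (fun n => form (u n - v) (u n - v) + ‖((u n - v : domain) : Lp ℝ 2 μ)‖ ^ 2) atTop (𝓝 0)
  /-- the unit contraction `u ↦ (0 ∨ u) ∧ 1` operates on the form -/
  markov : ∀ u : domain, ∃ v : domain,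
    ((v : Lp ℝ 2 μ) : X → ℝ) =ᵐ[μ] (fun x => max 0 (min (((u : Lp ℝ 2 μ) : X → ℝ) x) 1)) ∧
    form v v ≤ form u u

/-- `P` (restricted to times `t ≥ 0`) is the heat semigroup on `L²(X, μ)` associated with the
Dirichlet form `E`: the strongly continuous semigroup of symmetric contractions whose
approximating forms `t⁻¹ ⟪u - P_t u, v⟫` converge to `E` as `t → 0⁺`, the domain of `E` being the
set of all `u` for which the limit with `v = u` is finite. -/
structure DirichletForm.IsHeatSemigroup {X : Type*} [MeasurableSpace X] {μ : Measure X}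
    (E : DirichletForm μ) (P : ℝ → Lp ℝ 2 μ →L[ℝ] Lp ℝ 2 μ) : Prop where
  zero : ∀ u, P 0 u = u
  add : ∀ s t : ℝ, 0 ≤ s → 0 ≤ t → ∀ u, P (s + t) u = P s (P t u)
  symm : ∀ t : ℝ, 0 ≤ t → ∀ u v, inner ℝ (P t u) v = inner ℝ u (P t v)
  contraction : ∀ t : ℝ, 0 ≤ t → ∀ u, ‖P t u‖ ≤ ‖u‖
  strongly_continuous : ∀ u, Tendsto (fun t => P t u) (𝓝[>] 0) (𝓝 u)
  mem_domain_iff : ∀ u : Lp ℝ 2 μ, u ∈ E.domain ↔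
    ∃ c : ℝ, Tendsto (fun t : ℝ => t⁻¹ * inner ℝ (u - P t u) u) (𝓝[>] 0) (𝓝 c)
  tendsto_form : ∀ u v : E.domain,
    Tendsto (fun t : ℝ => t⁻¹ * inner ℝ ((u : Lp ℝ 2 μ) - P t u) (v : Lp ℝ 2 μ))
      (𝓝[>] 0) (𝓝 (E.form u v))

/-- The operator with kernel `k t` for `t > 0`, acting on functions:
`P_t f (x) = ∫ k_t(x, y) f(y) dμ(y)`. -/
noncomputable def heatOp {X : Type*} [MeasurableSpace X] (μ : Measure X)
    (k : ℝ → X → X → ℝ) (t : ℝ) (f : X → ℝ) (x : X) : ℝ :=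
  ∫ y, k t x y * f y ∂μ

/-- `k` is a heat kernel (a nonnegative measurable density with respect to `μ`) of the semigroup
`P` on `L²(X, μ)`. -/
structure IsHeatKernel {X : Type*} [MeasurableSpace X] (μ : Measure X)
    (P : ℝ → Lp ℝ 2 μ →L[ℝ] Lp ℝ 2 μ) (k : ℝ → X → X → ℝ) : Prop where
  measurable : ∀ t : ℝ, 0 < t → Measurable (Function.uncurry (k t))
  nonneg : ∀ t : ℝ, 0 < t → ∀ x y, 0 ≤ k t x y
  apply_eq : ∀ t : ℝ, 0 < t → ∀ u : Lp ℝ 2 μ,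
    (P t u : X → ℝ) =ᵐ[μ] heatOp μ k t (u : X → ℝ)

/-- The semigroup with heat kernel `k` is conservative: `P_t 1 = 1` for all `t > 0`. -/
def IsConservative {X : Type*} [MeasurableSpace X] (μ : Measure X) (k : ℝ → X → X → ℝ) : Prop :=
  ∀ t : ℝ, 0 < t → heatOp μ k t (fun _ => 1) =ᵐ[μ] (fun _ => 1)

/-- `t^{-α} (∫ P_t(|f - f(y)|^p)(y) dμ(y))^{1/p}`, with values in `[0, ∞]`. -/
noncomputable def heatVariation {X : Type*} [MeasurableSpace X] (μ : Measure X)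
    (k : ℝ → X → X → ℝ) (p α : ℝ) (f : X → ℝ) (t : ℝ) : ℝ≥0∞ :=
  ENNReal.ofReal (t ^ (-α)) *
    (∫⁻ y, ∫⁻ x, ENNReal.ofReal (k t y x * |f x - f y| ^ p) ∂μ ∂μ) ^ (1 / p)

/-- Membership in the heat semigroup based Besov class `B^{p, α}(X)`. -/
def MemBesov {X : Type*} [MeasurableSpace X] (μ : Measure X)
    (k : ℝ → X → X → ℝ) (p α : ℝ) (f : X → ℝ) : Prop :=
  MemLp f (ENNReal.ofReal p) μ ∧ limsup (heatVariation μ k p α f) (𝓝[>] 0) < ∞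

/-- The critical exponent `α_p`: the supremum of all `α > 0` for which `B^{p, α}(X)` contains a
function that is not almost everywhere constant. -/
noncomputable def critExponent {X : Type*} [MeasurableSpace X] (μ : Measure X)
    (k : ℝ → X → X → ℝ) (p : ℝ) : ℝ :=
  sSup {α : ℝ | 0 < α ∧ ∃ f : X → ℝ, MemBesov μ k p α f ∧ ¬ ∃ c : ℝ, f =ᵐ[μ] fun _ => c}

/-- Membership in the Sobolev class `W^{1,p}(E)` for `p > 1`, and in `BV(E)` for `p = 1`. -/
def MemSobolev {X : Type*} [MeasurableSpace X] (μ : Measure X)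
    (k : ℝ → X → X → ℝ) (p : ℝ) (f : X → ℝ) : Prop :=
  MemBesov μ k p (critExponent μ k p) f

/-- The total `p`-variation `Var_{p,E}(f)`, with values in `[0, ∞]`. -/
noncomputable def totalVar {X : Type*} [MeasurableSpace X] (μ : Measure X)
    (k : ℝ → X → X → ℝ) (p : ℝ) (f : X → ℝ) : ℝ≥0∞ :=
  liminf (heatVariation μ k p (critExponent μ k p) f) (𝓝[>] 0)

/-- The `L^p` pseudo-Poincaré inequality with constant `C` (at `t = 0` it is trivial, because
`P_0 f = f`). -/
def PseudoPoincare {X : Type*} [MeasurableSpace X] (μ : Measure X)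
    (k : ℝ → X → X → ℝ) (p C : ℝ) : Prop :=
  ∀ t : ℝ, 0 < t → ∀ f : X → ℝ, MemSobolev μ k p f →
    eLpNorm (fun x => heatOp μ k t f x - f x) (ENNReal.ofReal p) μ ≤
      ENNReal.ofReal (C * t ^ critExponent μ k p) * totalVar μ k p f

/-! ### Dyadic slices of the real line -/

/-! The proof is the truncation method: a weak type inequality for each dyadic slice `f_n` of `|f|`,
followed by summation over `n`. Weak type (`rpow_mul_measure_superlevel_le`): for `g ≥ 0` and a
level `s`, choose `t` so that the kernel bound gives `P_t g ≤ s/2` a.e. On `{g ≥ s}` then `|P_t g -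
g| ≥ s/2`, and Chebyshev with the pseudo-Poincaré inequality bounds `s^q μ{g ≥ s}` by a multiple of
`‖g‖₁^(pα/β) Var(g)^p`, where `q = p + pα/β`. Apply this to `g = f_n` at `s = 2^n`, with `‖f_n‖₁ ≤
‖f‖₁`. The left sides sum to at least `4^(-q) ∫ |f|^q`; the right sides are summable because `∑
Var(f_n)^p ≤ Var(f)^p` (`tsum_totalVar_dyadicSlice_le`), so nothing is lost in passing from weak to
strong type. -/

/-- The part of `a` that lies between the levels `2 ^ n` and `2 ^ (n + 1)`. -/
noncomputable def dyadicSlice (n : ℤ) (a : ℝ) : ℝ :=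
  min a (2 ^ (n + 1)) - min a (2 ^ n)

theorem two_zpow_le_succ (n : ℤ) : (2 : ℝ) ^ n ≤ 2 ^ (n + 1) :=
  zpow_le_zpow_right₀ one_le_two (by omega)

theorem two_zpow_succ (n : ℤ) : (2 : ℝ) ^ (n + 1) = 2 * 2 ^ n := by
  rw [zpow_add_one₀ two_ne_zero, mul_comm]

theorem dyadicSlice_nonneg (n : ℤ) (a : ℝ) : 0 ≤ dyadicSlice n a :=
  sub_nonneg.2 (min_le_min_left a (two_zpow_le_succ n))

theorem dyadicSlice_of_le {n : ℤ} {a : ℝ} (h : a ≤ 2 ^ n) : dyadicSlice n a = 0 := by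
  rw [dyadicSlice, min_eq_left h, min_eq_left (h.trans (two_zpow_le_succ n)), sub_self]

theorem dyadicSlice_of_ge {n : ℤ} {a : ℝ} (h : 2 ^ (n + 1) ≤ a) : dyadicSlice n a = 2 ^ n := by
  rw [dyadicSlice, min_eq_right h, min_eq_right ((two_zpow_le_succ n).trans h), two_zpow_succ]
  ring

theorem dyadicSlice_le_self (n : ℤ) {a : ℝ} (ha : 0 ≤ a) : dyadicSlice n a ≤ a := by
  have h : (0 : ℝ) ≤ min a (2 ^ n) := le_min ha (by positivity)
  exact (sub_le_self _ h).trans (min_le_left _ _)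

theorem continuous_dyadicSlice (n : ℤ) : Continuous (dyadicSlice n) := by
  unfold dyadicSlice
  fun_prop

theorem monotone_dyadicSlice (n : ℤ) : Monotone (dyadicSlice n) := by
  intro a b hab
  have h := two_zpow_le_succ n
  simp only [dyadicSlice]
  rcases le_total a (2 ^ n) with h1 | h1 <;> rcases le_total b (2 ^ n) with h2 | h2 <;>
  rcases le_total a (2 ^ (n + 1)) with h3 | h3 <;> rcases le_total b (2 ^ (n + 1)) with h4 | h4 <;>
  simp only [min_eq_left, min_eq_right, *] <;> linarith

theorem sum_range_dyadicSlice (m : ℤ) (N : ℕ) (a : ℝ) :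
    ∑ i ∈ Finset.range N, dyadicSlice (m + i) a = min a (2 ^ (m + N)) - min a (2 ^ m) := by
  have h := Finset.sum_range_sub (fun i : ℕ => min a ((2 : ℝ) ^ (m + i))) N
  simpa [dyadicSlice, add_assoc] using h

/-- By monotonicity all slice differences have the same sign, so over a block of consecutive levels
they telescope to the difference of two truncations. -/
theorem sum_abs_dyadicSlice_sub_le (s : Finset ℤ) (a b : ℝ) :
    ∑ n ∈ s, |dyadicSlice n a - dyadicSlice n b| ≤ |a - b| := by
  wlog hab : b ≤ a generalizing a b
  · simpa only [abs_sub_comm] using this b a (le_of_not_ge hab)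
  obtain ⟨m, hm⟩ := s.bddBelow
  obtain ⟨M, hM⟩ := s.bddAbove
  set N : ℕ := (M + 1 - m).toNat
  have hsub : s ⊆ (Finset.range N).image (fun i : ℕ => m + (i : ℤ)) := by
    intro n hn
    have h1 := hm hn
    have h2 := hM hn
    refine Finset.mem_image.2 ⟨(n - m).toNat, Finset.mem_range.2 ?_, ?_⟩ <;> omega
  calc ∑ n ∈ s, |dyadicSlice n a - dyadicSlice n b|
      ≤ ∑ n ∈ (Finset.range N).image (fun i : ℕ => m + (i : ℤ)),
          |dyadicSlice n a - dyadicSlice n b| :=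
        Finset.sum_le_sum_of_subset_of_nonneg hsub fun _ _ _ => abs_nonneg _
    _ = ∑ i ∈ Finset.range N, (dyadicSlice (m + i) a - dyadicSlice (m + i) b) := by
        rw [Finset.sum_image (by intro i _ j _ h; simpa using h)]
        exact Finset.sum_congr rfl fun i _ =>
          abs_of_nonneg (sub_nonneg.2 (monotone_dyadicSlice _ hab))
    _ = (min a (2 ^ (m + N)) - min a (2 ^ m)) - (min b (2 ^ (m + N)) - min b (2 ^ m)) := by
        rw [Finset.sum_sub_distrib, sum_range_dyadicSlice, sum_range_dyadicSlice]
    _ ≤ a - b := by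
        have h1 : min b ((2 : ℝ) ^ m) ≤ min a (2 ^ m) := min_le_min_right _ hab
        have h2 : min a ((2 : ℝ) ^ (m + N)) - min b (2 ^ (m + N)) ≤ a - b := by
          rcases le_total b ((2 : ℝ) ^ (m + (N : ℤ))) with h | h
          · rw [min_eq_left h]; linarith [min_le_left a ((2 : ℝ) ^ (m + (N : ℤ)))]
          · rw [min_eq_right h]; linarith [min_le_right a ((2 : ℝ) ^ (m + (N : ℤ)))]
        linarith
    _ ≤ |a - b| := le_abs_self _

theorem sum_rpow_abs_dyadicSlice_sub_le {p : ℝ} (hp : 1 ≤ p) (s : Finset ℤ) (a b : ℝ) :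
    ∑ n ∈ s, |dyadicSlice n (|a|) - dyadicSlice n (|b|)| ^ p ≤ |a - b| ^ p := by
  have hsum : ∑ n ∈ s, |dyadicSlice n (|a|) - dyadicSlice n (|b|)| ≤ |a - b| :=
    (sum_abs_dyadicSlice_sub_le s |a| |b|).trans (abs_abs_sub_abs_le a b)
  -- Since `p ≥ 1`, the `ℓ¹` bound gives the `ℓ^p` bound: one factor is kept and the other `p - 1`
  -- are bounded by `|a - b|`.
  have hterm : ∀ n ∈ s, |dyadicSlice n (|a|) - dyadicSlice n (|b|)| ^ p ≤
      |dyadicSlice n (|a|) - dyadicSlice n (|b|)| * |a - b| ^ (p - 1) := by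
    intro n hn
    have hle : |dyadicSlice n (|a|) - dyadicSlice n (|b|)| ≤ |a - b| :=
      (Finset.single_le_sum (f := fun n => |dyadicSlice n (|a|) - dyadicSlice n (|b|)|)
        (fun _ _ => abs_nonneg _) hn).trans hsum
    calc |dyadicSlice n (|a|) - dyadicSlice n (|b|)| ^ p
        = |dyadicSlice n (|a|) - dyadicSlice n (|b|)| *
            |dyadicSlice n (|a|) - dyadicSlice n (|b|)| ^ (p - 1) := by
          rw [← Real.rpow_one_add' (abs_nonneg _) (by linarith)]; ring_nf
      _ ≤ _ := by gcongr
  calc ∑ n ∈ s, |dyadicSlice n (|a|) - dyadicSlice n (|b|)| ^ p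
      ≤ (∑ n ∈ s, |dyadicSlice n (|a|) - dyadicSlice n (|b|)|) * |a - b| ^ (p - 1) := by
        rw [Finset.sum_mul]; exact Finset.sum_le_sum hterm
    _ ≤ |a - b| * |a - b| ^ (p - 1) := by gcongr
    _ = |a - b| ^ p := by
        rw [← Real.rpow_one_add' (abs_nonneg _) (by linarith)]; ring_nf

theorem abs_dyadicSlice_abs_sub_le (n : ℤ) (a b : ℝ) :
    |dyadicSlice n (|a|) - dyadicSlice n (|b|)| ≤ |a - b| := by
  simpa using (sum_abs_dyadicSlice_sub_le {n} |a| |b|).trans (abs_abs_sub_abs_le a b)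

/-- Slices vanish below `2^n`, which makes those of an `L^p` function integrable even if the
function itself is not. -/
theorem dyadicSlice_le_mul_rpow {p : ℝ} (hp : 1 ≤ p) (n : ℤ) {a : ℝ} (ha : 0 ≤ a) :
    dyadicSlice n a ≤ ((2 : ℝ) ^ n) ^ (1 - p) * a ^ p := by
  have h2 : (0 : ℝ) < 2 ^ n := by positivity
  rcases le_total a (2 ^ n) with h | h
  · rw [dyadicSlice_of_le h]; positivity
  · have ha' : 0 < a := h2.trans_le h
    calc dyadicSlice n a ≤ a := dyadicSlice_le_self n ha
      _ = a ^ (1 - p) * a ^ p := by rw [← Real.rpow_add ha']; simp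
      _ ≤ _ := by
        refine mul_le_mul_of_nonneg_right ?_ (by positivity)
        exact Real.rpow_le_rpow_of_nonpos h2 h (sub_nonpos.2 hp)

/-! ### Slices of functions: integrability, level sets and Fatou for sums -/

section Slices

variable {X : Type*} [MeasurableSpace X] {μ : Measure X}

/-- Superadditivity of the lower integral, which needs no measurability of the summands. -/
theorem sum_lintegral_le {ι : Type*} (s : Finset ι) (g : ι → X → ℝ≥0∞) :
    ∑ n ∈ s, ∫⁻ x, g n x ∂μ ≤ ∫⁻ x, ∑ n ∈ s, g n x ∂μ := by
  classical
  induction s using Finset.induction_on with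
  | empty => simp
  | insert n s hn ih =>
    simp only [Finset.sum_insert hn]
    exact (add_le_add_right ih _).trans (le_lintegral_add _ _)

/-- Fatou's lemma for the counting measure. -/
theorem tsum_liminf_le_liminf_tsum {ι κ : Type*} [Countable κ] {u : Filter ι}
    [u.IsCountablyGenerated] (g : κ → ι → ℝ≥0∞) :
    ∑' n, liminf (g n) u ≤ liminf (fun t => ∑' n, g n t) u := by
  let _ : MeasurableSpace κ := ⊤
  simpa only [lintegral_count] using
    lintegral_liminf_le (μ := Measure.count) (f := fun t n => g n t) (u := u)
      fun _ => measurable_from_top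

theorem integrable_dyadicSlice {p : ℝ} (hp : 1 ≤ p) (n : ℤ) {f : X → ℝ}
    (hf : MemLp f (ENNReal.ofReal p) μ) : Integrable (fun x => dyadicSlice n |f x|) μ := by
  have hint : Integrable (fun x => ((2 : ℝ) ^ n) ^ (1 - p) * ‖f x‖ ^ p) μ := by
    have h := hf.integrable_norm_rpow (by simp; linarith) (by simp)
    rw [ENNReal.toReal_ofReal (by linarith)] at h
    exact h.const_mul _
  refine hint.mono' ((continuous_dyadicSlice n).comp_aestronglyMeasurable hf.1.norm) ?_
  refine Eventually.of_forall fun x => ?_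
  rw [Real.norm_of_nonneg (dyadicSlice_nonneg _ _)]
  exact dyadicSlice_le_mul_rpow hp n (abs_nonneg _)

theorem eLpNorm_dyadicSlice_le (q : ℝ≥0∞) (n : ℤ) (f : X → ℝ) :
    eLpNorm (fun x => dyadicSlice n |f x|) q μ ≤ eLpNorm f q μ := by
  refine eLpNorm_mono fun x => ?_
  rw [Real.norm_of_nonneg (dyadicSlice_nonneg _ _)]
  exact dyadicSlice_le_self n (abs_nonneg _)

/-- The integral of `|f| ^ q` is controlled by the measures of the dyadic level sets. -/
theorem lintegral_rpow_le_tsum_dyadic {q : ℝ} (hq : 0 < q) {f : X → ℝ}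
    (hf : AEStronglyMeasurable f μ) :
    ∫⁻ x, ‖f x‖ₑ ^ q ∂μ ≤ ENNReal.ofReal 4 ^ q *
      ∑' n : ℤ, ENNReal.ofReal (2 ^ n) ^ q * μ {x | 2 ^ n ≤ dyadicSlice n |f x|} := by
  have hmeas : ∀ n : ℤ, NullMeasurableSet {x | (2 : ℝ) ^ n ≤ dyadicSlice n |f x|} μ := fun n =>
    nullMeasurableSet_le aemeasurable_const
      ((continuous_dyadicSlice n).comp_aestronglyMeasurable hf.norm).aemeasurable
  calc ∫⁻ x, ‖f x‖ₑ ^ q ∂μ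
      ≤ ∫⁻ x, ∑' n : ℤ, {x | (2 : ℝ) ^ n ≤ dyadicSlice n |f x|}.indicator
          (fun _ => ENNReal.ofReal 4 ^ q * ENNReal.ofReal (2 ^ n) ^ q) x ∂μ := by
        refine lintegral_mono fun x => ?_
        rcases eq_or_ne (f x) 0 with h0 | h0
        · simp [h0, ENNReal.zero_rpow_of_pos hq]
        obtain ⟨n, hn⟩ := exists_mem_Ico_zpow (abs_pos.2 h0) (one_lt_two (α := ℝ))
        -- If `2^n ≤ |f x| < 2^(n+1)`, the slice one level lower is full at `x`, and `|f x| < 4 *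
        -- 2^(n-1)`; hence the factor 4.
        refine le_trans ?_ (ENNReal.le_tsum (n - 1))
        have hmem : x ∈ {x | (2 : ℝ) ^ (n - 1) ≤ dyadicSlice (n - 1) |f x|} :=
          (dyadicSlice_of_ge (by simpa using hn.1)).ge
        rw [Set.indicator_of_mem hmem, ← ENNReal.mul_rpow_of_nonneg _ _ hq.le,
          ← ENNReal.ofReal_mul (by norm_num), ← ofReal_norm, Real.norm_eq_abs]
        gcongr
        have h1 := two_zpow_succ n
        have h2 := two_zpow_succ (n - 1)
        rw [sub_add_cancel] at h2
        linarith [hn.2]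
    _ = ∑' n : ℤ, ENNReal.ofReal 4 ^ q * ENNReal.ofReal (2 ^ n) ^ q *
          μ {x | (2 : ℝ) ^ n ≤ dyadicSlice n |f x|} := by
        rw [lintegral_tsum fun n => aemeasurable_const.indicator₀ (hmeas n)]
        exact tsum_congr fun n => lintegral_indicator_const₀ (hmeas n) _
    _ = _ := by simp only [mul_assoc, ENNReal.tsum_mul_left]

end Slices

/-! ### Heat variation of slices, weak type inequality and summation -/

section Heat

variable {X : Type*} [MeasurableSpace X] {μ : Measure X} {k : ℝ → X → X → ℝ} {p : ℝ}

/-- This includes the empty and the unbounded set, where the real `sSup` is 0. -/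
theorem critExponent_nonneg : 0 ≤ critExponent μ k p :=
  Real.sSup_nonneg fun _ h => h.1.le

theorem heatVariation_rpow (hp : 1 ≤ p) (α : ℝ) (f : X → ℝ) (t : ℝ) :
    heatVariation μ k p α f t ^ p = ENNReal.ofReal (t ^ (-α)) ^ p *
      ∫⁻ y, ∫⁻ x, ENNReal.ofReal (k t y x * |f x - f y| ^ p) ∂μ ∂μ := by
  rw [heatVariation, ENNReal.mul_rpow_of_nonneg _ _ (by linarith), ← ENNReal.rpow_mul,
    one_div_mul_cancel (by linarith), ENNReal.rpow_one]

theorem heatVariation_mono (hp : 1 ≤ p) (α : ℝ) {f g : X → ℝ} {t : ℝ}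
    (hk : ∀ x y, 0 ≤ k t x y) (hfg : ∀ x y, |g x - g y| ≤ |f x - f y|) :
    heatVariation μ k p α g t ≤ heatVariation μ k p α f t := by
  unfold heatVariation
  refine mul_le_mul_right (ENNReal.rpow_le_rpow ?_ (by positivity)) _
  refine lintegral_mono fun y => lintegral_mono fun x => ENNReal.ofReal_le_ofReal ?_
  refine mul_le_mul_of_nonneg_left ?_ (hk y x)
  exact Real.rpow_le_rpow (abs_nonneg _) (hfg x y) (by linarith)

theorem tsum_heatVariation_dyadicSlice_le (hp : 1 ≤ p) (α : ℝ) (f : X → ℝ) {t : ℝ}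
    (hk : ∀ x y, 0 ≤ k t x y) :
    ∑' n : ℤ, heatVariation μ k p α (fun x => dyadicSlice n |f x|) t ^ p ≤
      heatVariation μ k p α f t ^ p := by
  simp only [heatVariation_rpow hp, ENNReal.tsum_mul_left]
  gcongr
  refine ENNReal.summable.tsum_le_of_sum_le fun s => ?_
  refine (sum_lintegral_le s _).trans (lintegral_mono fun y => ?_)
  refine (sum_lintegral_le s _).trans (lintegral_mono fun x => ?_)
  rw [← ENNReal.ofReal_sum_of_nonneg fun n _ => mul_nonneg (hk y x) (by positivity),
    ← Finset.mul_sum]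
  exact ENNReal.ofReal_le_ofReal
    (mul_le_mul_of_nonneg_left (sum_rpow_abs_dyadicSlice_sub_le hp s _ _) (hk y x))

/-- The power map is an order isomorphism of `[0, ∞]`, so it commutes with `liminf`. -/
theorem totalVar_rpow (hp : 1 ≤ p) (f : X → ℝ) :
    totalVar μ k p f ^ p =
      liminf (fun t => heatVariation μ k p (critExponent μ k p) f t ^ p) (𝓝[>] 0) :=
  (ENNReal.orderIsoRpow p (by linarith)).liminf_apply

theorem tsum_totalVar_dyadicSlice_le (hp : 1 ≤ p) (hk : ∀ t : ℝ, 0 < t → ∀ x y, 0 ≤ k t x y)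
    (f : X → ℝ) :
    ∑' n : ℤ, totalVar μ k p (fun x => dyadicSlice n |f x|) ^ p ≤ totalVar μ k p f ^ p := by
  simp only [totalVar_rpow hp]
  refine (tsum_liminf_le_liminf_tsum _).trans (liminf_le_liminf ?_)
  filter_upwards [self_mem_nhdsWithin] with t ht
  exact tsum_heatVariation_dyadicSlice_le hp _ f (hk t ht)

theorem MemSobolev.dyadicSlice (hp : 1 ≤ p) (hk : ∀ t : ℝ, 0 < t → ∀ x y, 0 ≤ k t x y)
    {f : X → ℝ} (hf : MemSobolev μ k p f) (n : ℤ) :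
    MemSobolev μ k p (fun x => dyadicSlice n |f x|) := by
  refine ⟨⟨(continuous_dyadicSlice n).comp_aestronglyMeasurable hf.1.1.norm,
    (eLpNorm_dyadicSlice_le _ n f).trans_lt hf.1.2⟩, lt_of_le_of_lt (limsup_le_limsup ?_) hf.2⟩
  filter_upwards [self_mem_nhdsWithin] with t ht
  exact heatVariation_mono hp _ (hk t ht) fun x y => abs_dyadicSlice_abs_sub_le n _ _

theorem aestronglyMeasurable_heatOp [SFinite μ] {t : ℝ}
    (hk : Measurable (Function.uncurry (k t))) {f : X → ℝ} (hf : AEStronglyMeasurable f μ) :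
    AEStronglyMeasurable (heatOp μ k t f) μ :=
  (hk.aestronglyMeasurable.mul hf.comp_snd).integral_prod_right'

/-- Ultracontractivity: a bound on the kernel bounds the operator from `L¹` to `L^∞`. -/
theorem heatOp_le_of_kernel_le [SFinite μ] {t B : ℝ} (hk : ∀ x y, 0 ≤ k t x y)
    (hB : ∀ᵐ z ∂(μ.prod μ), k t z.1 z.2 ≤ B) {g : X → ℝ} (hg : ∀ x, 0 ≤ g x)
    (hgi : Integrable g μ) : ∀ᵐ x ∂μ, heatOp μ k t g x ≤ B * ∫ y, g y ∂μ := by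
  filter_upwards [Measure.ae_ae_of_ae_prod hB] with x hx
  rw [heatOp, ← integral_const_mul]
  refine integral_mono_of_nonneg (Eventually.of_forall fun y => mul_nonneg (hk x y) (hg y))
    (hgi.const_mul B) ?_
  filter_upwards [hx] with y hy
  exact mul_le_mul_of_nonneg_right hy (hg y)

/-- The weak type inequality that follows from ultracontractivity and the pseudo-Poincaré
inequality. -/
theorem rpow_mul_measure_superlevel_le [SFinite μ] (hp : 1 ≤ p) {Ch β Cp : ℝ}
    (hmeas : ∀ t : ℝ, 0 < t → Measurable (Function.uncurry (k t)))
    (hk : ∀ t : ℝ, 0 < t → ∀ x y, 0 ≤ k t x y) (hCh : 0 < Ch) (hβ : 0 < β)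
    (hB : ∀ t : ℝ, 0 < t → ∀ᵐ z ∂(μ.prod μ), k t z.1 z.2 ≤ Ch * t ^ (-β))
    (hCp : 0 < Cp) (hPP : PseudoPoincare μ k p Cp) {g : X → ℝ} (hg : ∀ x, 0 ≤ g x)
    (hgS : MemSobolev μ k p g) (hgi : Integrable g μ) {s : ℝ} (hs : 0 < s) :
    ENNReal.ofReal s ^ (p + p * critExponent μ k p / β) * μ {x | s ≤ g x} ≤
      ENNReal.ofReal 2 ^ (p + p * critExponent μ k p / β) * ENNReal.ofReal Cp ^ p *
        (ENNReal.ofReal Ch * eLpNorm g 1 μ) ^ (p * critExponent μ k p / β) *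
        totalVar μ k p g ^ p := by
  set α := critExponent μ k p with hα
  have hα0 : 0 ≤ α := critExponent_nonneg
  have hp0 : 0 < p := by linarith
  have hγ0 : 0 ≤ p * α / β := by positivity
  set N := ∫ x, g x ∂μ with hN
  have hN0 : 0 ≤ N := integral_nonneg hg
  have hNorm : eLpNorm g 1 μ = ENNReal.ofReal N := by
    rw [eLpNorm_one_eq_lintegral_enorm, hN,
      ofReal_integral_eq_lintegral_ofReal hgi (Eventually.of_forall hg)]
    exact lintegral_congr fun x => Real.enorm_of_nonneg (hg x)
  -- If `N = 0`, the time chosen below would not be positive; but then `g = 0` a.e.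
  rcases hN0.eq_or_lt with h0 | hNpos
  · have hzero : g =ᵐ[μ] 0 := (integral_eq_zero_iff_of_nonneg hg hgi).1 h0.symm
    have : μ {x | s ≤ g x} = 0 := by
      refine measure_mono_null (fun x hx => ?_) hzero
      simp only [Set.mem_compl_iff, Set.mem_ofPred_eq, Pi.zero_apply] at hx ⊢
      linarith
    simp [this]
  -- `t = r^(1/β)` solves `Ch * t^(-β) * N = s / 2`.
  set r := 2 * Ch * N / s with hr
  have hrpos : 0 < r := by positivity
  set t := r ^ (1 / β) with ht
  have htpos : 0 < t := Real.rpow_pos_of_pos hrpos _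
  have htβ : Ch * t ^ (-β) * N = s / 2 := by
    rw [ht, ← Real.rpow_mul hrpos.le, show 1 / β * -β = -1 by field_simp, Real.rpow_neg_one, hr]
    field_simp
  have htα : (Cp * t ^ α) ^ p = Cp ^ p * r ^ (p * α / β) := by
    rw [Real.mul_rpow hCp.le (by positivity), ht, ← Real.rpow_mul hrpos.le,
      ← Real.rpow_mul hrpos.le]
    congr 2
    field_simp
  have hcheb : ENNReal.ofReal (s / 2) ^ p * μ {x | s ≤ g x} ≤
      ENNReal.ofReal (Cp * t ^ α) ^ p * totalVar μ k p g ^ p := by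
    have hsub : μ {x | s ≤ g x} ≤ μ {x | ENNReal.ofReal (s / 2) ≤ ‖heatOp μ k t g x - g x‖ₑ} := by
      refine measure_mono_ae ?_
      filter_upwards [heatOp_le_of_kernel_le (hk t htpos) (hB t htpos) hg hgi] with x hx hxs
      have hxs' : s ≤ g x := hxs
      rw [← hN, htβ] at hx
      change ENNReal.ofReal (s / 2) ≤ ‖heatOp μ k t g x - g x‖ₑ
      rw [← ofReal_norm, Real.norm_eq_abs, abs_sub_comm]
      exact ENNReal.ofReal_le_ofReal (le_trans (by linarith) (le_abs_self _))
    have h := mul_meas_ge_le_pow_eLpNorm' μ (p := ENNReal.ofReal p) (by simpa using hp0) (by simp)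
      ((aestronglyMeasurable_heatOp (hmeas t htpos) hgS.1.1).sub hgS.1.1)
      (ENNReal.ofReal (s / 2))
    rw [ENNReal.toReal_ofReal hp0.le] at h
    rw [← ENNReal.mul_rpow_of_nonneg _ _ hp0.le]
    refine (mul_le_mul_right hsub _).trans (h.trans ?_)
    exact ENNReal.rpow_le_rpow (hPP t htpos g hgS) hp0.le
  have hleft : ENNReal.ofReal s ^ (p + p * α / β) =
      ENNReal.ofReal (2 ^ p * s ^ (p * α / β)) * ENNReal.ofReal (s / 2) ^ p := by
    rw [ENNReal.ofReal_rpow_of_pos hs, ENNReal.ofReal_rpow_of_pos (by positivity),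
      ← ENNReal.ofReal_mul (by positivity), Real.div_rpow hs.le zero_le_two, Real.rpow_add hs]
    congr 1
    field_simp
  have hright : ENNReal.ofReal (2 ^ p * s ^ (p * α / β)) * ENNReal.ofReal (Cp * t ^ α) ^ p =
      ENNReal.ofReal 2 ^ (p + p * α / β) * ENNReal.ofReal Cp ^ p *
        (ENNReal.ofReal Ch * eLpNorm g 1 μ) ^ (p * α / β) := by
    rw [hNorm, ← ENNReal.ofReal_mul hCh.le, ENNReal.ofReal_rpow_of_pos (by positivity),
      ENNReal.ofReal_rpow_of_pos (by positivity), ENNReal.ofReal_rpow_of_pos (by positivity),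
      ENNReal.ofReal_rpow_of_pos (by positivity), ← ENNReal.ofReal_mul (by positivity),
      ← ENNReal.ofReal_mul (by positivity), ← ENNReal.ofReal_mul (by positivity), htα, hr,
      mul_assoc 2 Ch N, Real.div_rpow (by positivity) hs.le,
      Real.mul_rpow zero_le_two (by positivity), Real.rpow_add zero_lt_two]
    congr 1
    field_simp
  rw [hleft, ← hright, mul_assoc, mul_assoc]
  exact mul_le_mul_right hcheb _

theorem lintegral_rpow_le_totalVar [SFinite μ] (hp : 1 ≤ p) {Ch β Cp : ℝ}
    (hmeas : ∀ t : ℝ, 0 < t → Measurable (Function.uncurry (k t)))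
    (hk : ∀ t : ℝ, 0 < t → ∀ x y, 0 ≤ k t x y) (hCh : 0 < Ch) (hβ : 0 < β)
    (hB : ∀ t : ℝ, 0 < t → ∀ᵐ z ∂(μ.prod μ), k t z.1 z.2 ≤ Ch * t ^ (-β))
    (hCp : 0 < Cp) (hPP : PseudoPoincare μ k p Cp) {f : X → ℝ} (hf : MemSobolev μ k p f) :
    ∫⁻ x, ‖f x‖ₑ ^ (p + p * critExponent μ k p / β) ∂μ ≤
      ENNReal.ofReal 8 ^ (p + p * critExponent μ k p / β) * ENNReal.ofReal Cp ^ p *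
        (ENNReal.ofReal Ch * eLpNorm f 1 μ) ^ (p * critExponent μ k p / β) *
        totalVar μ k p f ^ p := by
  have hα0 : 0 ≤ critExponent μ k p := critExponent_nonneg
  have hγ0 : 0 ≤ p * critExponent μ k p / β := by positivity
  have hq0 : 0 < p + p * critExponent μ k p / β := by positivity
  set γ := p * critExponent μ k p / β
  set K := ENNReal.ofReal 2 ^ (p + γ) * ENNReal.ofReal Cp ^ p *
    (ENNReal.ofReal Ch * eLpNorm f 1 μ) ^ γ with hK
  have hlevel : ∀ n : ℤ,
      ENNReal.ofReal (2 ^ n) ^ (p + γ) * μ {x | 2 ^ n ≤ dyadicSlice n |f x|} ≤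
        K * totalVar μ k p (fun x => dyadicSlice n |f x|) ^ p := by
    intro n
    refine (rpow_mul_measure_superlevel_le hp hmeas hk hCh hβ hB hCp hPP
      (fun x => dyadicSlice_nonneg n _) (hf.dyadicSlice hp hk n)
      (integrable_dyadicSlice hp n hf.1) (by positivity)).trans ?_
    rw [hK]
    gcongr
    exact eLpNorm_dyadicSlice_le 1 n f
  calc ∫⁻ x, ‖f x‖ₑ ^ (p + γ) ∂μ
      ≤ ENNReal.ofReal 4 ^ (p + γ) *
          ∑' n : ℤ, ENNReal.ofReal (2 ^ n) ^ (p + γ) * μ {x | 2 ^ n ≤ dyadicSlice n |f x|} :=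
        lintegral_rpow_le_tsum_dyadic hq0 hf.1.1
    _ ≤ ENNReal.ofReal 4 ^ (p + γ) *
          ∑' n : ℤ, K * totalVar μ k p (fun x => dyadicSlice n |f x|) ^ p := by
        exact mul_le_mul_right (ENNReal.tsum_le_tsum hlevel) _
    _ ≤ ENNReal.ofReal 4 ^ (p + γ) * (K * totalVar μ k p f ^ p) := by
        rw [ENNReal.tsum_mul_left]
        gcongr
        exact tsum_totalVar_dyadicSlice_le hp hk f
    _ = _ := by
        -- The 4 comes from the dyadic decomposition, the 2 from halving the level in the weak type
        -- inequality.
        rw [hK, show (8 : ℝ) = 4 * 2 by norm_num, ENNReal.ofReal_mul (by norm_num),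
          ENNReal.mul_rpow_of_nonneg _ _ hq0.le]
        ring

end Heat

theorem theoremT (p : ℝ) (hp : 1 ≤ p) :
    ∃ c : ℝ, 0 < c ∧
      ∀ (X : Type*) [MeasurableSpace X] (μ : Measure X) [SigmaFinite μ]
        (E : DirichletForm μ) (P : ℝ → Lp ℝ 2 μ →L[ℝ] Lp ℝ 2 μ) (k : ℝ → X → X → ℝ)
        (Ch β Cp : ℝ),
        E.IsHeatSemigroup P → IsHeatKernel μ P k → IsConservative μ k →
        0 < Ch → 0 < β →
        (∀ t : ℝ, 0 < t → ∀ᵐ z ∂(μ.prod μ), k t z.1 z.2 ≤ Ch * t ^ (-β)) →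
        0 < Cp → PseudoPoincare μ k p Cp →
        ∀ f : X → ℝ, MemSobolev μ k p f →
          eLpNorm f (ENNReal.ofReal (p * (1 + critExponent μ k p / β))) μ ≤
            ENNReal.ofReal
                (c * Cp ^ (β / (β + critExponent μ k p)) *
                  Ch ^ (critExponent μ k p / (β + critExponent μ k p))) *
              totalVar μ k p f ^ (β / (β + critExponent μ k p)) *
              eLpNorm f 1 μ ^ (critExponent μ k p / (β + critExponent μ k p)) := by 
  refine ⟨8, by norm_num, ?_⟩
  intro X _ μ _ E P k Ch β Cp _ hker _ hCh hβ hB hCp hPP f hf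
  have hα0 : 0 ≤ critExponent μ k p := critExponent_nonneg
  have hmain := lintegral_rpow_le_totalVar hp hker.measurable hker.nonneg hCh hβ hB hCp hPP hf
  set α := critExponent μ k p
  have hp0 : 0 < p := by linarith
  have hq : p * (1 + α / β) = p + p * α / β := by ring
  have hq0 : 0 < p + p * α / β := by positivity
  have hβα : 0 < β + α := by positivity
  -- Exponents after taking the `q`-th root; the constant `8^q` becomes 8.
  have h1 : p * (p + p * α / β)⁻¹ = β / (β + α) := by field_simp
  have h2 : p * α / β * (p + p * α / β)⁻¹ = α / (β + α) := by field_simp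
  rw [hq, eLpNorm_eq_lintegral_rpow_enorm_toReal (by simpa using hq0) (by simp),
    ENNReal.toReal_ofReal hq0.le, one_div]
  refine (ENNReal.rpow_le_rpow hmain (inv_nonneg.2 hq0.le)).trans_eq ?_
  have hi : 0 ≤ (p + p * α / β)⁻¹ := inv_nonneg.2 hq0.le
  have hα' : 0 ≤ α / (β + α) := by positivity
  rw [ENNReal.mul_rpow_of_nonneg _ _ hi, ENNReal.mul_rpow_of_nonneg _ _ hi,
    ENNReal.mul_rpow_of_nonneg _ _ hi, ← ENNReal.rpow_mul, ← ENNReal.rpow_mul,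
    ← ENNReal.rpow_mul, ← ENNReal.rpow_mul, mul_inv_cancel₀ hq0.ne', h1, h2, ENNReal.rpow_one,
    ENNReal.mul_rpow_of_nonneg _ _ hα', ENNReal.ofReal_mul (by positivity),
    ENNReal.ofReal_mul (by norm_num), ENNReal.ofReal_rpow_of_pos hCp,
    ENNReal.ofReal_rpow_of_pos hCh]
  ring
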